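/- Let $F$ be the free group on a set $\mathbf x$ and let $\mathcal P=(\mathbf x,\mathbf r)$, $\mathbf r\subseteq F$, be a group presentation. Let $Y$ be the set of formal symbols ${}^u r$ ($u\in F$, $r\in\mathbf r$), and let $Y\cup Y^{-1}$ be the set of symbols $({}^u r)^{\varepsilon}$, $\varepsilon=\pm1$; put $\theta(({}^u r)^{\varepsilon})=ur^{\varepsilon}u^{-1}$ and ${}^{w}(({}^{u}r)^{\varepsilon})=({}^{wu}r)^{\varepsilon}$ for $w\in F$. Finite sequences over $Y\cup Y^{-1}$ are called $Y$-sequences; such a sequence is an identity $Y$-sequence if the product of the values of $\theta$ on its terms is $1$. Peiffer equivalence of $Y$-sequences is the equivalence relation generated by the exchanges of an adjacent pair $(a,b)$ for $({}^{\theta(a)}b,a)$ or for $(b,{}^{\theta(b)^{-1}}a)$ and by the deletions of adjacent pairs $(a,a^{-1})$. The presentation $\mathcal P$ is aspherical if every identity $Y$-sequence is Peiffer equivalent to the empty sequence. Let $\Upsilon$ be the monoid generated by $Y\cup Y^{-1}$ subject to the relations $ab=({}^{\theta(a)}b)\,a$ for $a,b\in Y\cup Y^{-1}$, let $\sigma$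 be the canonical map from $Y$-sequences to $\Upsilon$, let $\mu:\Upsilon\to\mathcal G(\Upsilon)$ be the universal enveloping group of $\Upsilon$, and let $\tilde\theta:\mathcal G(\Upsilon)\to F$ be the homomorphism $\mu\sigma(({}^u r)^{\varepsilon})\mapsto ur^{\varepsilon}u^{-1}$. The action of $F$ on symbols induces an action on $\mathcal G(\Upsilon)$. Let $\sim_{\mathfrak U}$ be the equivalence relation on $\Upsilon$ generated by the pairs $(s,\,s\,\sigma(a)\sigma(a^{-1}))$, $s\in\Upsilon$, $a\in Y\cup Y^{-1}$. Let $r_0\in\mathbf r$, let $\mathcal P_1=(\mathbf x,\mathbf r_1)$ with $\mathbf r_1=\mathbf r\setminus\{r_0\}$, and let $N_0$ be the normal closure of $r_0$ in $F$. Objects formed from $\mathcal P_1$ carry the index $1$. Let $\tilde\Pi_1=\operatorname{Ker}\tilde\theta_1$, which is a central subgroup of $\mathcal G(\Upsilon_1)$ stable under $F$; let $[\tilde\Pi_1,N_0]$ be the subgroup of $\tilde\Pi_1$ generated by the elements ${}^{n}d\,d^{-1}$ with $d\in\tilde\Pi_1$, $n\in N_0$; let $\hat{\mathfrak A}_1$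 be the subgroup of $\mathcal G(\Upsilon)$ generated by the elements $\mu\sigma(bb^{-1})$ with $b\in Y_1\cup Y_1^{-1}$; and let $\hat f:\mathcal G(\Upsilon_1)\to\mathcal G(\Upsilon)$ be the homomorphism induced by the inclusion $Y_1\subseteq Y$. **Theorem.** Suppose that $\mathcal P$ is aspherical. Then $\hat f$ induces a homomorphism $\hat\varphi:\tilde\Pi_1/[\tilde\Pi_1,N_0]\to\hat{\mathfrak A}_1$, and $\mathcal P_1$ is aspherical if and only if both of the following hold: (1) for every identity $Y_1$-sequence $d=(a_1,\dots,a_n)$ and every $n_0\in N_0$, the sequence ${}^{n_0}d\,d^{-1}=({}^{n_0}a_1,\dots,{}^{n_0}a_n,a_n^{-1},\dots,a_1^{-1})$ satisfies $\sigma_1({}^{n_0}d\,d^{-1})\sim_{\mathfrak U_1}1$; (2) $\hat\varphi$ is an isomorphism. -/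

import Mathlib

namespace Peiffer

universe u

/-! ### Universal enveloping group of a monoid presentation -/

section Enveloping

variable {A : Type u}

/-- The canonical homomorphism from the free monoid to the free group on `A`. -/
def wordToFreeGroup : FreeMonoid A →* FreeGroup A := FreeMonoid.lift FreeGroup.of

/-- The group relators `u * v⁻¹`, one for each defining pair `(u, v)` of a monoid presentation. -/
def envelopingRels (rels : FreeMonoid A → FreeMonoid A → Prop) : Set (FreeGroup A) :=
  {w | ∃ p q, rels p q ∧ w = wordToFreeGroup p * (wordToFreeGroup q)⁻¹}

/-- The universal enveloping group of the monoid presented by `rels`. -/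
abbrev EnvelopingGroup (rels : FreeMonoid A → FreeMonoid A → Prop) : Type u :=
  PresentedGroup (envelopingRels rels)

theorem lift_comp_wordToFreeGroup {G : Type*} [Group G] (g : A → G) (w : FreeMonoid A) :
    FreeGroup.lift g (wordToFreeGroup w) = FreeMonoid.lift g w := by
  have : (FreeGroup.lift g).comp wordToFreeGroup = FreeMonoid.lift g := by
    ext a; simp [wordToFreeGroup]
  exact DFunLike.congr_fun this w

theorem lift_of_eq_mk {M : Type*} [Monoid M] {rels : FreeMonoid A → FreeMonoid A → Prop}
    (g : PresentedMonoid rels →* M) (w : FreeMonoid A) :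
    FreeMonoid.lift (fun a => g (PresentedMonoid.of rels a)) w = g (PresentedMonoid.mk rels w) := by
  have : FreeMonoid.lift (fun a => g (PresentedMonoid.of rels a))
      = g.comp (PresentedMonoid.mk rels) := by
    ext a; simp [PresentedMonoid.of]
  exact DFunLike.congr_fun this w

/-- The canonical map `μ` from a presented monoid to its universal enveloping group. -/
def toEnveloping (rels : FreeMonoid A → FreeMonoid A → Prop) :
    PresentedMonoid rels →* EnvelopingGroup rels :=
  PresentedMonoid.lift (fun a => PresentedGroup.of a) (by
    intro p q h
    have key : ∀ w : FreeMonoid A, FreeMonoid.lift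
        (fun a => (PresentedGroup.of a : EnvelopingGroup rels)) w
        = PresentedGroup.mk (envelopingRels rels) (wordToFreeGroup w) := by
      intro w
      have : FreeMonoid.lift (fun a => (PresentedGroup.of a : EnvelopingGroup rels))
          = (PresentedGroup.mk (envelopingRels rels)).comp wordToFreeGroup := by
        ext a; simp [wordToFreeGroup, PresentedGroup.of]
      exact DFunLike.congr_fun this w
    change FreeMonoid.lift _ p = FreeMonoid.lift _ q
    rw [key, key, ← mul_inv_eq_one, ← map_inv, ← map_mul]
    exact PresentedGroup.one_of_mem ⟨p, q, h, rfl⟩)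

/-- The universal property of `μ`: a monoid homomorphism `g` into a group extends uniquely to the
universal enveloping group. -/
def envelopingLift {G : Type*} [Group G] {rels : FreeMonoid A → FreeMonoid A → Prop}
    (g : PresentedMonoid rels →* G) : EnvelopingGroup rels →* G :=
  PresentedGroup.toGroup (f := fun a => g (PresentedMonoid.of rels a)) (by
    rintro w ⟨p, q, h, rfl⟩
    rw [map_mul, map_inv, lift_comp_wordToFreeGroup, lift_comp_wordToFreeGroup, lift_of_eq_mk,
      lift_of_eq_mk, PresentedMonoid.mk_eq_mk_of_rel h, mul_inv_cancel])

theorem envelopingLift_comp_toEnveloping {G : Type*} [Group G]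
    {rels : FreeMonoid A → FreeMonoid A → Prop} (g : PresentedMonoid rels →* G) :
    (envelopingLift g).comp (toEnveloping rels) = g := by
  apply PresentedMonoid.ext
  intro a
  simp [envelopingLift, toEnveloping]

theorem enveloping_hom_ext {G : Type*} [Group G]
    {rels : FreeMonoid A → FreeMonoid A → Prop} {g h : EnvelopingGroup rels →* G}
    (H : ∀ a, g (toEnveloping rels (PresentedMonoid.of rels a))
      = h (toEnveloping rels (PresentedMonoid.of rels a))) : g = h := by
  apply PresentedGroup.ext
  intro a
  simpa [toEnveloping] using H a

end Enveloping

/-! ### `Y`-sequences, Peiffer operations, asphericity -/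

variable {X : Type u}

/-- The symbols `(ᵘr)^ε` with `u` in the free group `F` on `X`, `r` a relator and `ε = ± 1`, that
is, the elements of `Y ∪ Y⁻¹`. -/
@[ext]
structure YSymbol (R : Set (FreeGroup X)) where
  conj : FreeGroup X
  rel : R
  sign : ℤˣ

namespace YSymbol

variable {R : Set (FreeGroup X)}

/-- The formal inverse `(ᵘr)^(-ε)` of `(ᵘr)^ε`. -/
def inv (a : YSymbol R) : YSymbol R := ⟨a.conj, a.rel, -a.sign⟩

/-- `θ((ᵘr)^ε) = u r^ε u⁻¹`. -/
def theta (a : YSymbol R) : FreeGroup X :=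
  a.conj * (a.rel : FreeGroup X) ^ (a.sign : ℤ) * a.conj⁻¹

/-- The action `ʷ((ᵘr)^ε) = (ʷᵘr)^ε` of `F`. -/
instance : MulAction (FreeGroup X) (YSymbol R) where
  smul w a := ⟨w * a.conj, a.rel, a.sign⟩
  one_smul a := by
    change (⟨1 * a.conj, a.rel, a.sign⟩ : YSymbol R) = a
    rw [one_mul]
  mul_smul v w a := by
    change (⟨v * w * a.conj, a.rel, a.sign⟩ : YSymbol R) = ⟨v * (w * a.conj), a.rel, a.sign⟩
    rw [mul_assoc]

theorem smul_def (w : FreeGroup X) (a : YSymbol R) : w • a = ⟨w * a.conj, a.rel, a.sign⟩ := rfl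

theorem theta_smul (w : FreeGroup X) (a : YSymbol R) : (w • a).theta = w * a.theta * w⁻¹ := by
  simp [smul_def, theta, mul_assoc]

/-- The inclusion of symbols induced by an inclusion of sets of relators. -/
def incl {R S : Set (FreeGroup X)} (h : R ⊆ S) (a : YSymbol R) : YSymbol S :=
  ⟨a.conj, Set.inclusion h a.rel, a.sign⟩

end YSymbol

/-- `Y`-sequences, with concatenation as product. -/
abbrev YSeq (R : Set (FreeGroup X)) : Type u := FreeMonoid (YSymbol R)

namespace YSeq

variable {R : Set (FreeGroup X)}

/-- `∏ uᵢ rᵢ^εᵢ uᵢ⁻¹` in `F`. -/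
def theta : YSeq R →* FreeGroup X := FreeMonoid.lift YSymbol.theta

/-- Identity `Y`-sequences. -/
def IsIdentity (d : YSeq R) : Prop := theta d = 1

/-- The action of `w ∈ F`, symbol by symbol. -/
def act (w : FreeGroup X) : YSeq R →* YSeq R := FreeMonoid.map (fun a => w • a)

/-- The formal inverse: `(a₁, …, aₙ)` becomes `(aₙ⁻¹, …, a₁⁻¹)`. -/
def inv (d : YSeq R) : YSeq R := FreeMonoid.reverse (FreeMonoid.map YSymbol.inv d)

end YSeq

open FreeMonoid in
/-- Elementary Peiffer exchanges and Peiffer deletions. -/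
inductive PeifferStep {R : Set (FreeGroup X)} : YSeq R → YSeq R → Prop
  | exchangeLeft (p q : YSeq R) (a b : YSymbol R) :
      PeifferStep (p * (of a * of b) * q) (p * (of (a.theta • b) * of a) * q)
  | exchangeRight (p q : YSeq R) (a b : YSymbol R) :
      PeifferStep (p * (of a * of b) * q) (p * (of b * of (b.theta⁻¹ • a)) * q)
  | deletion (p q : YSeq R) (a : YSymbol R) :
      PeifferStep (p * (of a * of a.inv) * q) (p * q)

/-- Peiffer equivalence of `Y`-sequences (insertions are the inverses of deletions). -/
def PeifferEquiv {R : Set (FreeGroup X)} : YSeq R → YSeq R → Prop :=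
  Relation.EqvGen PeifferStep

/-- The presentation `(X, R)` is aspherical: every identity `Y`-sequence is Peiffer equivalent to
the empty sequence. -/
def IsAspherical (R : Set (FreeGroup X)) : Prop :=
  ∀ d : YSeq R, d.IsIdentity → PeifferEquiv d 1

/-! ### The monoid `Υ` and its group `𝒢(Υ)` -/

section Upsilon

variable (R : Set (FreeGroup X))

/-- The defining pairs `(ab, (^{θ(a)}b) a)` of `Υ`, with `a, b ∈ Y ∪ Y⁻¹`. -/
def upsilonRels : YSeq R → YSeq R → Prop := fun p q =>
  ∃ a b : YSymbol R, p = FreeMonoid.of a * FreeMonoid.of b ∧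
    q = FreeMonoid.of (a.theta • b) * FreeMonoid.of a

/-- The monoid `Υ`. -/
abbrev Upsilon : Type u := PresentedMonoid (upsilonRels R)

/-- The group `𝒢(Υ)`. -/
abbrev GUpsilon : Type u := EnvelopingGroup (upsilonRels R)

/-- The canonical map `σ` from `Y`-sequences to `Υ`. -/
def sigma : YSeq R →* Upsilon R := PresentedMonoid.mk (upsilonRels R)

/-- The canonical map `μ` from `Υ` to `𝒢(Υ)`. -/
def mu : Upsilon R →* GUpsilon R := toEnveloping (upsilonRels R)

variable {R}

theorem of_mul_of (a b : YSymbol R) :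
    PresentedMonoid.of (upsilonRels R) a * PresentedMonoid.of (upsilonRels R) b
      = PresentedMonoid.of (upsilonRels R) (a.theta • b) * PresentedMonoid.of (upsilonRels R) a :=
  PresentedMonoid.mk_eq_mk_of_rel (rels := upsilonRels R)
    (x := FreeMonoid.of a * FreeMonoid.of b)
    (y := FreeMonoid.of (a.theta • b) * FreeMonoid.of a) ⟨a, b, rfl, rfl⟩

/-- Two elements of `Υ` are Peiffer equivalent if they are related by the equivalence relation
generated by the pairs `(σ(α), σ(α) σ(a) σ(a⁻¹))`. -/
def UpsilonPeifferEquiv : Upsilon R → Upsilon R → Prop :=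
  Relation.EqvGen fun s t => ∃ (p : YSeq R) (a : YSymbol R), s = sigma R p ∧
    t = sigma R p * (sigma R (FreeMonoid.of a) * sigma R (FreeMonoid.of a.inv))

/-- Homomorphisms out of `Υ`. -/
def upsilonLift {M : Type*} [Monoid M] (g : YSymbol R → M)
    (hg : ∀ a b : YSymbol R, g a * g b = g (a.theta • b) * g a) : Upsilon R →* M :=
  PresentedMonoid.lift g (by
    rintro p q ⟨a, b, rfl, rfl⟩
    simpa using hg a b)

@[simp]
theorem upsilonLift_of {M : Type*} [Monoid M] (g : YSymbol R → M)
    (hg : ∀ a b : YSymbol R, g a * g b = g (a.theta • b) * g a) (a : YSymbol R) :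
    upsilonLift g hg (PresentedMonoid.of _ a) = g a := rfl

/-- Homomorphisms out of `𝒢(Υ)`. -/
def gUpsilonLift {G : Type*} [Group G] (g : YSymbol R → G)
    (hg : ∀ a b : YSymbol R, g a * g b = g (a.theta • b) * g a) : GUpsilon R →* G :=
  envelopingLift (upsilonLift g hg)

/-- The image of a symbol in `𝒢(Υ)`. -/
def gen (a : YSymbol R) : GUpsilon R := mu R (sigma R (FreeMonoid.of a))

@[simp]
theorem gUpsilonLift_gen {G : Type*} [Group G] (g : YSymbol R → G)
    (hg : ∀ a b : YSymbol R, g a * g b = g (a.theta • b) * g a) (a : YSymbol R) :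
    gUpsilonLift g hg (gen a) = g a :=
  DFunLike.congr_fun (envelopingLift_comp_toEnveloping (upsilonLift g hg))
    (PresentedMonoid.of _ a)

theorem gUpsilon_hom_ext {G : Type*} [Group G] {g h : GUpsilon R →* G}
    (H : ∀ a, g (gen a) = h (gen a)) : g = h :=
  enveloping_hom_ext H

theorem gen_mul_gen (a b : YSymbol R) : gen a * gen b = gen (a.theta • b) * gen a := by
  have := congrArg (mu R) (of_mul_of a b)
  rwa [map_mul, map_mul] at this

/-- The homomorphism `θ̃ : 𝒢(Υ) → F` with `(ᵘr)^ε ↦ u r^ε u⁻¹`. -/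
def thetaTilde : GUpsilon R →* FreeGroup X :=
  gUpsilonLift YSymbol.theta (by intro a b; rw [YSymbol.theta_smul]; group)

/-- The endomorphism of `𝒢(Υ)` by which `w ∈ F` acts, with `(ᵘr)^ε ↦ (ʷᵘr)^ε`. -/
def actHom (w : FreeGroup X) : GUpsilon R →* GUpsilon R :=
  gUpsilonLift (fun a => gen (w • a)) (by
    intro a b
    rw [gen_mul_gen, YSymbol.theta_smul, smul_smul, smul_smul]
    simp)

/-- The action of `F` on `𝒢(Υ)`. -/
instance : MulDistribMulAction (FreeGroup X) (GUpsilon R) where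
  smul w g := actHom w g
  one_smul g := by
    have : actHom (1 : FreeGroup X) = MonoidHom.id (GUpsilon R) :=
      gUpsilon_hom_ext fun a => by simp [actHom]
    exact DFunLike.congr_fun this g
  mul_smul v w g := by
    have : actHom (v * w) = (actHom v).comp (actHom (R := R) w) :=
      gUpsilon_hom_ext fun a => by simp [actHom, mul_smul]
    exact DFunLike.congr_fun this g
  smul_one w := map_one (actHom w)
  smul_mul w := map_mul (actHom w)

theorem smul_gen (w : FreeGroup X) (a : YSymbol R) : w • gen a = gen (w • a) :=
  gUpsilonLift_gen _ _ a

theorem thetaTilde_gen (a : YSymbol R) : thetaTilde (gen a) = a.theta :=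
  gUpsilonLift_gen _ _ a

theorem thetaTilde_smul (w : FreeGroup X) (g : GUpsilon R) :
    thetaTilde (w • g) = w * thetaTilde g * w⁻¹ := by
  have : thetaTilde.comp (actHom w)
      = (MulAut.conj w).toMonoidHom.comp (thetaTilde (R := R)) :=
    gUpsilon_hom_ext fun a => by
      simp only [MonoidHom.comp_apply]
      change thetaTilde (w • gen a) = _
      rw [smul_gen, thetaTilde_gen, thetaTilde_gen, YSymbol.theta_smul]
      simp
  exact DFunLike.congr_fun this g

/-- The Peiffer identity in `𝒢(Υ)`. -/
theorem conj_eq_smul (g h : GUpsilon R) : g * h * g⁻¹ = thetaTilde g • h := by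
  have : (MulAut.conj : GUpsilon R →* MulAut (GUpsilon R))
      = (MulDistribMulAction.toMulAut (FreeGroup X) (GUpsilon R)).comp thetaTilde :=
    gUpsilon_hom_ext fun a => by
      apply MulEquiv.toMonoidHom_injective
      apply gUpsilon_hom_ext
      intro b
      change gen a * gen b * (gen a)⁻¹ = thetaTilde (gen a) • gen b
      rw [thetaTilde_gen, smul_gen, gen_mul_gen, mul_inv_cancel_right]
  exact DFunLike.congr_fun (DFunLike.congr_fun this g) h

variable (R)

/-- The generalized module of identities `Π̃`, the kernel of `θ̃`. -/
def PiTilde : Subgroup (GUpsilon R) := (thetaTilde (R := R)).ker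

variable {R}

theorem piTilde_central {g : GUpsilon R} (hg : g ∈ PiTilde R) (h : GUpsilon R) :
    g * h = h * g := by
  have := conj_eq_smul g h
  rw [MonoidHom.mem_ker.1 hg, one_smul] at this
  exact mul_inv_eq_iff_eq_mul.1 this

variable (R)

/-- The displacement subgroup `[Π̃, N]`, generated in `Π̃` by the elements `ⁿd d⁻¹` with `d ∈ Π̃`
and `n ∈ N`. -/
def displacement (N : Subgroup (FreeGroup X)) : Subgroup (PiTilde R) :=
  Subgroup.closure {x | ∃ d : PiTilde R, ∃ n ∈ N,
    (x : GUpsilon R) = (n • (d : GUpsilon R)) * (d : GUpsilon R)⁻¹}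

instance (N : Subgroup (FreeGroup X)) : (displacement R N).Normal where
  conj_mem x hx g := by
    have : g * x = x * g := Subtype.ext (piTilde_central g.2 x)
    rwa [this, mul_inv_cancel_right]

end Upsilon

/-! ### Subpresentations -/

section Sub

variable {R S : Set (FreeGroup X)}

/-- The homomorphism `f̂ : 𝒢(Υ₁) → 𝒢(Υ)` induced by an inclusion of sets of relators. -/
def fHat (h : R ⊆ S) : GUpsilon R →* GUpsilon S :=
  gUpsilonLift (fun a => gen (a.incl h)) fun a b => gen_mul_gen (a.incl h) (b.incl h)

/-- The subgroup `𝔄̂₁` of `𝒢(Υ)` generated by the elements `μσ(b b⁻¹)` with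
`b ∈ Y₁ ∪ Y₁⁻¹`. -/
def AHat (h : R ⊆ S) : Subgroup (GUpsilon S) :=
  Subgroup.closure {x | ∃ b : YSymbol R,
    x = mu S (sigma S (FreeMonoid.of (b.incl h) * FreeMonoid.of (b.incl h).inv))}

end Sub

end Peiffer

open Peiffer

/-! Let `C` be the subgroup of `𝒢(Υ)` generated by the elements `a a⁻¹` (`cancelPairs`). It is
central, stable under `F` and contained in `Π̃`, and modulo `C` formal inverses become inverses. So
Peiffer classes of sequences are governed by `𝒢(Υ)/C`, and asphericity means `Π̃ = C`
(`isAspherical_iff`).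

By the Peiffer identity, `θ̃(𝒢(Υ))` acts trivially on the central subgroup `Π̃`. As `N₀` lies in
this image for the large presentation, `f̂` kills `[Π̃₁, N₀]`. Sending positive symbols to `a a⁻¹`
and negative ones to `1` retracts `𝒢(Υ)` onto `C`; since `Π̃ = C` for the large presentation, this
forces `f̂(Π̃₁)` into `𝔄̂₁`. Hence `φ̂` exists, and it is onto because `𝔄̂₁ = f̂(C₁)`.

If `φ̂` is injective, each `d ∈ Π̃₁` agrees modulo `[Π̃₁, N₀]` with some `c ∈ C₁`, and condition (1)
says `[Π̃₁, N₀] ≤ C₁`; so `Π̃₁ = C₁`. Conversely, if `Π̃₁ = C₁`, counting only the positive symbols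
of `Y₁` gives a map from `𝒢(Υ)` to `Π̃₁/[Π̃₁, N₀]` that inverts `φ̂` on the left
(`phiHat_injective`). -/

namespace Peiffer

universe v

/-! ### The central subgroup generated by the elements `a a⁻¹` -/

section Cancellation

variable {X : Type v} {R : Set (FreeGroup X)}

namespace YSymbol

@[simp]
theorem inv_inv (a : YSymbol R) : a.inv.inv = a := by
  ext <;> simp [inv]

@[simp]
theorem theta_inv (a : YSymbol R) : a.inv.theta = a.theta⁻¹ := by
  simp [inv, theta, mul_assoc]

theorem smul_inv (w : FreeGroup X) (a : YSymbol R) : (w • a).inv = w • a.inv := rfl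

end YSymbol

/-- The image of a `Y`-sequence in `𝒢(Υ)`. -/
def seqImage (R : Set (FreeGroup X)) : YSeq R →* GUpsilon R := (mu R).comp (sigma R)

theorem seqImage_of (a : YSymbol R) : seqImage R (FreeMonoid.of a) = gen a := rfl

theorem thetaTilde_seqImage (d : YSeq R) : thetaTilde (seqImage R d) = YSeq.theta d := by
  have : (thetaTilde (R := R)).comp (seqImage R) = YSeq.theta :=
    FreeMonoid.hom_eq fun a => by simp [seqImage_of, thetaTilde_gen, YSeq.theta]
  exact DFunLike.congr_fun this d

theorem seqImage_act (w : FreeGroup X) (d : YSeq R) :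
    seqImage R (YSeq.act w d) = w • seqImage R d := by
  have : (seqImage R).comp (YSeq.act w) = (actHom w).comp (seqImage R) :=
    FreeMonoid.hom_eq fun a => (smul_gen w a).symm
  exact DFunLike.congr_fun this d

/-- The element `a a⁻¹` of `𝒢(Υ)`. -/
def pair (a : YSymbol R) : GUpsilon R := gen a * gen a.inv

theorem pair_mem_piTilde (a : YSymbol R) : pair a ∈ PiTilde R := by
  simp [PiTilde, MonoidHom.mem_ker, pair, thetaTilde_gen]

theorem smul_pair (w : FreeGroup X) (a : YSymbol R) : w • pair a = pair (w • a) := by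
  rw [pair, smul_mul', smul_gen, smul_gen, pair, YSymbol.smul_inv]

/-- Centrality gives `a (a⁻¹ a) = (a a⁻¹) a = a (a a⁻¹)`; cancel `a` on the left. -/
theorem pair_inv (a : YSymbol R) : pair a.inv = pair a := by
  have := piTilde_central (pair_mem_piTilde a) (gen a)
  rw [pair, mul_assoc] at this
  rw [pair, pair, YSymbol.inv_inv]
  exact mul_left_cancel this

/-- The image of `θ̃` acts trivially on the kernel of `θ̃`. -/
theorem thetaTilde_smul_of_mem_piTilde (g : GUpsilon R) {d : GUpsilon R} (hd : d ∈ PiTilde R) :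
    thetaTilde g • d = d := by
  rw [← conj_eq_smul, ← piTilde_central hd g, mul_inv_cancel_right]

theorem theta_smul_pair (a b : YSymbol R) : pair (a.theta • b) = pair b := by
  rw [← smul_pair, ← thetaTilde_gen, thetaTilde_smul_of_mem_piTilde _ (pair_mem_piTilde b)]

/-- The subgroup of `𝒢(Υ)` generated by the elements `a a⁻¹`. -/
def cancelPairs (R : Set (FreeGroup X)) : Subgroup (GUpsilon R) :=
  Subgroup.closure (Set.range pair)

theorem pair_mem_cancelPairs (a : YSymbol R) : pair a ∈ cancelPairs R :=
  Subgroup.subset_closure ⟨a, rfl⟩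

theorem cancelPairs_le_piTilde : cancelPairs R ≤ PiTilde R :=
  (Subgroup.closure_le _).2 (by rintro _ ⟨a, rfl⟩; exact pair_mem_piTilde a)

instance : (cancelPairs R).Normal where
  conj_mem x hx g := by
    rwa [← piTilde_central (cancelPairs_le_piTilde hx), mul_inv_cancel_right]

theorem smul_mem_cancelPairs (w : FreeGroup X) {g : GUpsilon R} (hg : g ∈ cancelPairs R) :
    w • g ∈ cancelPairs R := by
  have : cancelPairs R ≤ (cancelPairs R).comap (actHom w) :=
    (Subgroup.closure_le _).2 (by
      rintro _ ⟨a, rfl⟩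
      change w • pair a ∈ cancelPairs R
      rw [smul_pair]
      exact pair_mem_cancelPairs _)
  exact this hg

/-- The image of a `Y`-sequence in the quotient of `𝒢(Υ)` by all elements `a a⁻¹`. -/
def seqClass (R : Set (FreeGroup X)) : YSeq R →* GUpsilon R ⧸ cancelPairs R :=
  (QuotientGroup.mk' _).comp (seqImage R)

theorem seqClass_apply (d : YSeq R) :
    seqClass R d = QuotientGroup.mk (seqImage R d) := rfl

theorem seqClass_of_mul_of_inv (a : YSymbol R) :
    seqClass R (FreeMonoid.of a) * seqClass R (FreeMonoid.of a.inv) = 1 :=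
  (QuotientGroup.eq_one_iff (pair a)).2 (pair_mem_cancelPairs a)

theorem seqClass_inv (d : YSeq R) : seqClass R (YSeq.inv d) = (seqClass R d)⁻¹ := by
  induction d using FreeMonoid.inductionOn' with
  | one => exact (map_one _).trans (by rw [map_one, inv_one])
  | of_mul a d ih =>
    have h : YSeq.inv (FreeMonoid.of a * d) = YSeq.inv d * FreeMonoid.of a.inv := by
      simp only [YSeq.inv, map_mul, FreeMonoid.reverse_mul, FreeMonoid.map_of]
      rfl
    rw [h, map_mul, ih, map_mul, mul_inv_rev, mul_right_inj]
    exact (inv_eq_of_mul_eq_one_right (seqClass_of_mul_of_inv a)).symm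

theorem closure_range_gen : Subgroup.closure (Set.range (gen (R := R))) = ⊤ :=
  PresentedGroup.closure_range_of _

theorem exists_seqClass_eq (g : GUpsilon R) :
    ∃ d : YSeq R, seqClass R d = QuotientGroup.mk g := by
  have hg : g ∈ Subgroup.closure (Set.range (gen (R := R))) := by simp [closure_range_gen]
  induction hg using Subgroup.closure_induction with
  | mem x hx =>
    obtain ⟨a, rfl⟩ := hx
    exact ⟨FreeMonoid.of a, rfl⟩
  | one => exact ⟨1, map_one _⟩
  | mul x y _ _ hx hy =>
    obtain ⟨d, hd⟩ := hx
    obtain ⟨e, he⟩ := hy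
    exact ⟨d * e, by rw [map_mul, hd, he]; rfl⟩
  | inv x _ hx =>
    obtain ⟨d, hd⟩ := hx
    exact ⟨YSeq.inv d, by rw [seqClass_inv, hd]; rfl⟩

end Cancellation

/-! ### Peiffer equivalence and the quotient of `𝒢(Υ)` -/

section Equivalence

variable {X : Type v} {R : Set (FreeGroup X)}

theorem PeifferStep.mul_left {d e : YSeq R} (c : YSeq R) (h : PeifferStep d e) :
    PeifferStep (c * d) (c * e) := by
  cases h with
  | exchangeLeft p q a b => simpa only [mul_assoc] using PeifferStep.exchangeLeft (c * p) q a b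
  | exchangeRight p q a b => simpa only [mul_assoc] using PeifferStep.exchangeRight (c * p) q a b
  | deletion p q a => simpa only [mul_assoc] using PeifferStep.deletion (c * p) q a

theorem PeifferStep.mul_right {d e : YSeq R} (c : YSeq R) (h : PeifferStep d e) :
    PeifferStep (d * c) (e * c) := by
  cases h with
  | exchangeLeft p q a b => simpa only [mul_assoc] using PeifferStep.exchangeLeft p (q * c) a b
  | exchangeRight p q a b => simpa only [mul_assoc] using PeifferStep.exchangeRight p (q * c) a b
  | deletion p q a => simpa only [mul_assoc] using PeifferStep.deletion p (q * c) a

/-- A function that is constant along a relation up to an equivalence is so along the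
equivalence relation it generates. -/
theorem eqvGen_lift {α β : Type*} {r : α → α → Prop} {s : β → β → Prop} (f : α → β)
    (hf : ∀ x y, r x y → Relation.EqvGen s (f x) (f y)) {x y : α} (h : Relation.EqvGen r x y) :
    Relation.EqvGen s (f x) (f y) := by
  induction h with
  | rel x y h => exact hf x y h
  | refl x => exact .refl _
  | symm x y _ ih => exact ih.symm
  | trans x y z _ _ ih₁ ih₂ => exact ih₁.trans _ _ _ ih₂

/-- Peiffer equivalence as a congruence. -/
def peifferCon (R : Set (FreeGroup X)) : Con (YSeq R) where
  r := PeifferEquiv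
  iseqv := Relation.EqvGen.is_equivalence _
  mul' {_ x y _} h₁ h₂ :=
    (eqvGen_lift (· * y) (fun _ _ h => .rel _ _ (h.mul_right y)) h₁).trans _ _ _
      (eqvGen_lift (x * ·) (fun _ _ h => .rel _ _ (h.mul_left x)) h₂)

/-- The class of a symbol is invertible up to Peiffer equivalence. -/
def symbolUnit (a : YSymbol R) : (peifferCon R).Quotientˣ where
  val := (FreeMonoid.of a : YSeq R)
  inv := (FreeMonoid.of a.inv : YSeq R)
  val_inv := (Con.eq _).2 (.rel _ _ (by simpa using PeifferStep.deletion 1 1 a))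
  inv_val := (Con.eq _).2 (.rel _ _ (by simpa using PeifferStep.deletion 1 1 a.inv))

/-- The homomorphism from `𝒢(Υ)` to the group of Peiffer classes of `Y`-sequences. -/
def toPeifferClass (R : Set (FreeGroup X)) : GUpsilon R →* (peifferCon R).Quotientˣ :=
  gUpsilonLift symbolUnit fun a b => Units.ext <|
    (Con.eq (peifferCon R)).2 (.rel _ _ (by simpa using PeifferStep.exchangeLeft 1 1 a b))

theorem toPeifferClass_gen (a : YSymbol R) : toPeifferClass R (gen a) = symbolUnit a :=
  gUpsilonLift_gen _ _ a

theorem toPeifferClass_seqImage (d : YSeq R) :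
    (toPeifferClass R (seqImage R d) : (peifferCon R).Quotient) = d := by
  have : (Units.coeHom _).comp ((toPeifferClass R).comp (seqImage R)) = (peifferCon R).mk' :=
    FreeMonoid.hom_eq fun a =>
      congrArg Units.val (toPeifferClass_gen a)
  exact DFunLike.congr_fun this d

theorem cancelPairs_le_ker_toPeifferClass : cancelPairs R ≤ (toPeifferClass R).ker :=
  (Subgroup.closure_le _).2 (by
    rintro _ ⟨a, rfl⟩
    refine Units.ext ?_
    change (toPeifferClass R (seqImage R (FreeMonoid.of a * FreeMonoid.of a.inv)) :
      (peifferCon R).Quotient) = 1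
    rw [toPeifferClass_seqImage]
    exact (symbolUnit a).val_inv)

/-- `toPeifferClass` recovers the Peiffer class of a sequence from its image in `𝒢(Υ)` and kills
every `a a⁻¹`. -/
theorem peifferEquiv_one_of_seqImage_mem {d : YSeq R} (h : seqImage R d ∈ cancelPairs R) :
    PeifferEquiv d 1 := by
  have h₁ := congrArg Units.val (MonoidHom.mem_ker.1 (cancelPairs_le_ker_toPeifferClass h))
  rw [toPeifferClass_seqImage] at h₁
  exact (Con.eq (peifferCon R)).1 h₁

/-- Passing `a⁻¹` and then `a` across `b` twists `b` by `θ(a)⁻¹` and back by `θ(a)`. So a pair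
deleted inside a word can be moved to its end, where the relation on `Υ` allows deletion. -/
theorem sigma_pair_comm (a : YSymbol R) (q : YSeq R) :
    sigma R (FreeMonoid.of a) * sigma R (FreeMonoid.of a.inv) * sigma R q
      = sigma R q * (sigma R (FreeMonoid.of a) * sigma R (FreeMonoid.of a.inv)) := by
  have key (b : YSymbol R) : Commute
      (sigma R (FreeMonoid.of a) * sigma R (FreeMonoid.of a.inv)) (sigma R (FreeMonoid.of b)) := by
    have h₁ := of_mul_of a.inv b
    have h₂ := of_mul_of a (a.inv.theta • b)
    rw [YSymbol.theta_inv, smul_inv_smul] at h₂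
    rw [YSymbol.theta_inv] at h₁
    change _ * _ * PresentedMonoid.of (upsilonRels R) b = PresentedMonoid.of (upsilonRels R) b * _
    change PresentedMonoid.of _ a * PresentedMonoid.of _ a.inv * _
      = _ * (PresentedMonoid.of _ a * PresentedMonoid.of _ a.inv)
    rw [mul_assoc, h₁, ← mul_assoc, h₂, mul_assoc]
  induction q using FreeMonoid.inductionOn' with
  | one => simp
  | of_mul b q ih =>
    rw [map_mul]
    exact (key b).mul_right ih

theorem PeifferStep.upsilon {d e : YSeq R} (h : PeifferStep d e) :
    UpsilonPeifferEquiv (sigma R d) (sigma R e) := by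
  cases h with
  | exchangeLeft p q a b =>
    have h : sigma R (FreeMonoid.of a * FreeMonoid.of b)
        = sigma R (FreeMonoid.of (a.theta • b) * FreeMonoid.of a) := of_mul_of a b
    rw [map_mul, map_mul _ p, h, ← map_mul, ← map_mul]
    exact .refl _
  | exchangeRight p q a b =>
    have h : sigma R (FreeMonoid.of b * FreeMonoid.of (b.theta⁻¹ • a))
        = sigma R (FreeMonoid.of a * FreeMonoid.of b) := by
      -- A right exchange is the defining relation for `b` and `^{θ(b)⁻¹}a`, read backwards.
      have := of_mul_of b (b.theta⁻¹ • a)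
      rwa [smul_inv_smul] at this
    rw [map_mul, map_mul _ p, ← h, ← map_mul, ← map_mul]
    exact .refl _
  | deletion p q a =>
    refine .symm _ _ (.rel _ _ ⟨p * q, a, rfl, ?_⟩)
    simp only [map_mul]
    rw [mul_assoc, sigma_pair_comm, mul_assoc]

theorem PeifferEquiv.upsilon {d e : YSeq R} (h : PeifferEquiv d e) :
    UpsilonPeifferEquiv (sigma R d) (sigma R e) :=
  eqvGen_lift (sigma R) (fun _ _ h => h.upsilon) h

theorem UpsilonPeifferEquiv.mk_mu_eq {s t : Upsilon R} (h : UpsilonPeifferEquiv s t) :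
    (QuotientGroup.mk (mu R s) : GUpsilon R ⧸ cancelPairs R) = QuotientGroup.mk (mu R t) := by
  induction h with
  | rel _ _ h =>
    obtain ⟨p, a, rfl, rfl⟩ := h
    rw [QuotientGroup.eq, map_mul, inv_mul_cancel_left, map_mul]
    exact pair_mem_cancelPairs a
  | refl => rfl
  | symm _ _ _ ih => exact ih.symm
  | trans _ _ _ _ _ ih₁ ih₂ => exact ih₁.trans ih₂

theorem PeifferEquiv.seqClass_eq {d e : YSeq R} (h : PeifferEquiv d e) :
    seqClass R d = seqClass R e :=
  h.upsilon.mk_mu_eq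

/-- Any sequence representing the class of `g` is an identity sequence, because `θ̃` is trivial on
`cancelPairs R`. -/
theorem exists_isIdentity_seqClass_eq {g : GUpsilon R} (hg : g ∈ PiTilde R) :
    ∃ d : YSeq R, d.IsIdentity ∧ seqClass R d = QuotientGroup.mk g := by
  obtain ⟨d, hd⟩ := exists_seqClass_eq g
  refine ⟨d, ?_, hd⟩
  have h := cancelPairs_le_piTilde (QuotientGroup.eq.1 hd)
  rw [YSeq.IsIdentity, ← thetaTilde_seqImage, ← MonoidHom.mem_ker]
  exact inv_mem_iff.1 ((Subgroup.mul_mem_cancel_right _ hg).1 h)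

/-- A presentation is aspherical if and only if the generalized module of identities is generated
by the elements `a a⁻¹`. -/
theorem isAspherical_iff : IsAspherical R ↔ PiTilde R ≤ cancelPairs R := by
  constructor
  · intro h g hg
    obtain ⟨d, hd, hdg⟩ := exists_isIdentity_seqClass_eq hg
    rw [← QuotientGroup.eq_one_iff, ← hdg, (h d hd).seqClass_eq, map_one]
  · intro h d hd
    exact peifferEquiv_one_of_seqImage_mem
      (h (MonoidHom.mem_ker.2 ((thetaTilde_seqImage d).trans hd)))

end Equivalence

/-! ### Homomorphisms counting positive symbols -/

section Positive

variable {X : Type v} {R : Set (FreeGroup X)} {G : Type*} [Group G]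

/-- The homomorphism that sends a positive symbol `a` to `c a` and a negative one to `1`. -/
def positiveLift (c : YSymbol R → G) (hcomm : ∀ a b, c a * c b = c b * c a)
    (hc : ∀ a b : YSymbol R, c (a.theta • b) = c b) : GUpsilon R →* G :=
  gUpsilonLift (fun a => if a.sign = 1 then c a else 1) fun a b => by
    have hs : (a.theta • b).sign = b.sign := rfl
    simp only [hs, hc]
    split_ifs <;> simp [hcomm]

theorem positiveLift_gen (c : YSymbol R → G) (hcomm : ∀ a b, c a * c b = c b * c a)
    (hc : ∀ a b : YSymbol R, c (a.theta • b) = c b) (a : YSymbol R) :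
    positiveLift c hcomm hc (gen a) = if a.sign = 1 then c a else 1 :=
  gUpsilonLift_gen _ _ a

/-- Exactly one of `a`, `a⁻¹` is positive, and `c` agrees on both. -/
theorem positiveLift_pair (c : YSymbol R → G) (hcomm : ∀ a b, c a * c b = c b * c a)
    (hc : ∀ a b : YSymbol R, c (a.theta • b) = c b) (hinv : ∀ a, c a.inv = c a)
    (a : YSymbol R) : positiveLift c hcomm hc (pair a) = c a := by
  rw [pair, map_mul, positiveLift_gen, positiveLift_gen, hinv]
  rcases Int.units_eq_one_or a.sign with h | h <;> simp [h, YSymbol.inv]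

/-- The retraction of `𝒢(Υ)` onto the subgroup generated by the elements `a a⁻¹`. -/
def pairRetraction (R : Set (FreeGroup X)) : GUpsilon R →* GUpsilon R :=
  positiveLift pair (fun a b => piTilde_central (pair_mem_piTilde a) (pair b)) theta_smul_pair

theorem pairRetraction_of_mem {g : GUpsilon R} (hg : g ∈ cancelPairs R) :
    pairRetraction R g = g :=
  MonoidHom.eqOn_closure (f := pairRetraction R) (g := MonoidHom.id _)
    (by rintro _ ⟨a, rfl⟩; exact positiveLift_pair _ _ _ pair_inv a) hg

end Positive

/-! ### Subpresentations -/

section Subpresentation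

variable {X : Type v} {R S : Set (FreeGroup X)} (h : R ⊆ S)

theorem fHat_gen (a : YSymbol R) : fHat h (gen a) = gen (a.incl h) := gUpsilonLift_gen _ _ a

theorem fHat_pair (a : YSymbol R) : fHat h (pair a) = pair (a.incl h) := by
  rw [pair, map_mul, fHat_gen, fHat_gen]
  rfl

theorem fHat_smul (w : FreeGroup X) (g : GUpsilon R) : fHat h (w • g) = w • fHat h g := by
  have : (fHat h).comp (actHom w) = (actHom w).comp (fHat h) :=
    gUpsilon_hom_ext fun a => by
      change fHat h (w • gen a) = w • fHat h (gen a)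
      rw [smul_gen, fHat_gen, fHat_gen, smul_gen]
      rfl
  exact DFunLike.congr_fun this g

theorem thetaTilde_fHat (g : GUpsilon R) : thetaTilde (fHat h g) = thetaTilde g := by
  have : thetaTilde.comp (fHat h) = thetaTilde :=
    gUpsilon_hom_ext fun a => by
      rw [MonoidHom.comp_apply, fHat_gen, thetaTilde_gen, thetaTilde_gen]
      rfl
  exact DFunLike.congr_fun this g

theorem fHat_mem_piTilde {d : GUpsilon R} (hd : d ∈ PiTilde R) : fHat h d ∈ PiTilde S :=
  (thetaTilde_fHat h d).trans hd

theorem aHat_eq_closure : AHat h = Subgroup.closure (Set.range fun b : YSymbol R =>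
    pair (b.incl h)) := by
  rw [AHat]
  congr 1
  ext x
  exact exists_congr fun b => eq_comm

theorem aHat_eq_map : AHat h = (cancelPairs R).map (fHat h) := by
  rw [aHat_eq_closure, cancelPairs, MonoidHom.map_closure, ← Set.range_comp]
  exact congrArg _ (congrArg _ (funext fun b => (fHat_pair h b).symm))

theorem pairRetraction_fHat_mem (g : GUpsilon R) : pairRetraction S (fHat h g) ∈ AHat h := by
  have hg : g ∈ Subgroup.closure (Set.range (gen (R := R))) := by simp [closure_range_gen]
  have : Subgroup.closure (Set.range (gen (R := R)))
      ≤ (AHat h).comap ((pairRetraction S).comp (fHat h)) :=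
    (Subgroup.closure_le _).2 (by
      rintro _ ⟨a, rfl⟩
      change pairRetraction S (fHat h (gen a)) ∈ AHat h
      rw [fHat_gen, pairRetraction, positiveLift_gen]
      split_ifs
      · rw [aHat_eq_closure]
        exact Subgroup.subset_closure ⟨a, rfl⟩
      · exact one_mem _)
  exact this hg

/-- If the larger presentation is aspherical, `f̂` maps the module of identities of the smaller one
to `𝔄̂₁`. -/
theorem fHat_mem_aHat (hS : IsAspherical S) {d : GUpsilon R} (hd : d ∈ PiTilde R) :
    fHat h d ∈ AHat h := by
  -- Asphericity puts `f̂ d` among the elements that the retraction fixes.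
  rw [← pairRetraction_of_mem (isAspherical_iff.1 hS (fHat_mem_piTilde h hd))]
  exact pairRetraction_fHat_mem h d

/-- The image of `θ̃` is normal by equivariance and contains `r = θ(¹r)`. -/
theorem normalClosure_le_range_thetaTilde {r : FreeGroup X} (hr : r ∈ S) :
    Subgroup.normalClosure {r} ≤ (thetaTilde (R := S)).range := by
  have : (thetaTilde (R := S)).range.Normal := ⟨by
    rintro _ ⟨g, rfl⟩ w
    exact ⟨w • g, thetaTilde_smul w g⟩⟩
  refine Subgroup.normalClosure_le_normal (Set.singleton_subset_iff.2 ?_)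
  exact ⟨gen ⟨1, ⟨r, hr⟩, 1⟩, by simp [thetaTilde_gen, YSymbol.theta]⟩

theorem fHat_eq_one_of_mem_displacement {N : Subgroup (FreeGroup X)}
    (hN : N ≤ (thetaTilde (R := S)).range) {d : PiTilde R} (hd : d ∈ displacement R N) :
    fHat h (d : GUpsilon R) = 1 := by
  have : displacement R N ≤ ((fHat h).comp (PiTilde R).subtype).ker :=
    (Subgroup.closure_le _).2 (by
      rintro x ⟨d, n, hn, hx⟩
      obtain ⟨g, rfl⟩ := hN hn
      change fHat h (x : GUpsilon R) = 1
      rw [hx, map_mul, fHat_smul, map_inv,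
        thetaTilde_smul_of_mem_piTilde g (fHat_mem_piTilde h d.2), mul_inv_cancel])
  exact this hd

/-- The homomorphism from the module of identities modulo the displacement subgroup to `𝔄̂₁` that
`f̂` induces. -/
def phiHat (hS : IsAspherical S) (N : Subgroup (FreeGroup X))
    (hN : N ≤ (thetaTilde (R := S)).range) : (PiTilde R ⧸ displacement R N) →* AHat h :=
  QuotientGroup.lift _
    (((fHat h).comp (PiTilde R).subtype).codRestrict (AHat h) fun d => fHat_mem_aHat h hS d.2)
    fun _ hd => Subtype.ext (fHat_eq_one_of_mem_displacement h hN hd)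

theorem phiHat_mk (hS : IsAspherical S) (N : Subgroup (FreeGroup X))
    (hN : N ≤ (thetaTilde (R := S)).range) (d : PiTilde R) :
    (phiHat h hS N hN (QuotientGroup.mk d) : GUpsilon S) = fHat h (d : GUpsilon R) := rfl

/-- `𝔄̂₁` is already the image of `cancelPairs R`, which lies in `Π̃₁`. -/
theorem phiHat_surjective (hS : IsAspherical S) (N : Subgroup (FreeGroup X))
    (hN : N ≤ (thetaTilde (R := S)).range) : Function.Surjective (phiHat h hS N hN) := by
  rintro ⟨x, hx⟩
  obtain ⟨d, hd, rfl⟩ := (aHat_eq_map h ▸ hx : x ∈ (cancelPairs R).map (fHat h))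
  exact ⟨QuotientGroup.mk ⟨d, cancelPairs_le_piTilde hd⟩, Subtype.ext rfl⟩

/-- Carries condition (1) from sequences to all of `Π̃₁`: modulo the `F`-stable subgroup
`cancelPairs R`, every `d` comes from an identity sequence. -/
theorem smul_mul_inv_mem_cancelPairs {N : Subgroup (FreeGroup X)}
    (h₁ : ∀ d : YSeq R, d.IsIdentity → ∀ n ∈ N,
      UpsilonPeifferEquiv (sigma R (YSeq.act n d * YSeq.inv d)) 1)
    {d : GUpsilon R} (hd : d ∈ PiTilde R) {n : FreeGroup X} (hn : n ∈ N) :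
    n • d * d⁻¹ ∈ cancelPairs R := by
  obtain ⟨e, he, hed⟩ := exists_isIdentity_seqClass_eq hd
  have h₂ : seqClass R (YSeq.act n e * YSeq.inv e) = QuotientGroup.mk (mu R 1) :=
    (h₁ e he n hn).mk_mu_eq
  have h₃ : seqClass R (YSeq.act n e) = QuotientGroup.mk (n • d) := by
    rw [seqClass_apply, seqImage_act, QuotientGroup.eq, ← smul_inv', ← smul_mul']
    exact smul_mem_cancelPairs n (QuotientGroup.eq.1 hed)
  rw [map_mul, seqClass_inv, hed, h₃, map_one] at h₂
  exact (QuotientGroup.eq_one_iff _).1 h₂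

theorem isAspherical_of_phiHat_injective (hS : IsAspherical S) (N : Subgroup (FreeGroup X))
    (hN : N ≤ (thetaTilde (R := S)).range)
    (h₁ : ∀ d : YSeq R, d.IsIdentity → ∀ n ∈ N,
      UpsilonPeifferEquiv (sigma R (YSeq.act n d * YSeq.inv d)) 1)
    (h₂ : Function.Injective (phiHat h hS N hN)) : IsAspherical R := by
  rw [isAspherical_iff]
  intro d hd
  obtain ⟨c, hc, hcd⟩ := (aHat_eq_map h ▸ fHat_mem_aHat h hS hd :
    fHat h d ∈ (cancelPairs R).map (fHat h))
  have h₃ : (QuotientGroup.mk ⟨c, cancelPairs_le_piTilde hc⟩ : PiTilde R ⧸ displacement R N)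
      = QuotientGroup.mk ⟨d, hd⟩ := h₂ (Subtype.ext hcd)
  have h₄ : displacement R N ≤ (cancelPairs R).subgroupOf (PiTilde R) :=
    (Subgroup.closure_le _).2 (by
      rintro x ⟨d, n, hn, hx⟩
      change (x : GUpsilon R) ∈ cancelPairs R
      rw [hx]
      exact smul_mul_inv_mem_cancelPairs h₁ d.2 hn)
  have h₅ : c⁻¹ * d ∈ cancelPairs R := h₄ (QuotientGroup.eq.1 h₃)
  exact (Subgroup.mul_mem_cancel_left _ (inv_mem hc)).1 h₅

theorem upsilonPeifferEquiv_of_isAspherical (hR : IsAspherical R) {d : YSeq R}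
    (hd : d.IsIdentity) (n : FreeGroup X) :
    UpsilonPeifferEquiv (sigma R (YSeq.act n d * YSeq.inv d)) 1 := by
  -- Once this is known, asphericity applies to the new sequence itself.
  have h₁ : (YSeq.act n d * YSeq.inv d).IsIdentity := by
    have h₂ : seqClass R (YSeq.act n d) = 1 := by
      rw [seqClass_apply, seqImage_act, QuotientGroup.eq_one_iff]
      refine smul_mem_cancelPairs n ?_
      rw [← QuotientGroup.eq_one_iff, ← seqClass_apply, (hR d hd).seqClass_eq, map_one]
    have h₃ : seqClass R (YSeq.act n d * YSeq.inv d) = 1 := by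
      rw [map_mul, seqClass_inv, h₂, (hR d hd).seqClass_eq, map_one, one_mul, inv_one]
    rw [YSeq.IsIdentity, ← thetaTilde_seqImage]
    exact cancelPairs_le_piTilde ((QuotientGroup.eq_one_iff _).1 h₃)
  simpa using (hR _ h₁).upsilon

/-! ### A left inverse of `φ̂` -/

theorem mk_smul_eq_mk {N : Subgroup (FreeGroup X)} {n : FreeGroup X} (hn : n ∈ N)
    {d e : PiTilde R} (hde : (d : GUpsilon R) = n • (e : GUpsilon R)) :
    (QuotientGroup.mk d : PiTilde R ⧸ displacement R N) = QuotientGroup.mk e := by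
  rw [← mul_inv_eq_one, ← QuotientGroup.mk_inv, ← QuotientGroup.mk_mul, QuotientGroup.eq_one_iff]
  exact Subgroup.subset_closure ⟨e, n, hn, by simp [hde]⟩

open Classical in
/-- The class of `a a⁻¹` in the module of identities of the smaller presentation modulo the
displacement subgroup, and `1` if `a` does not belong to the smaller presentation. -/
noncomputable def restrictedPair (R : Set (FreeGroup X)) {S : Set (FreeGroup X)} (N : Subgroup (FreeGroup X))
    (a : YSymbol S) : PiTilde R ⧸ displacement R N :=
  if ha : (a.rel : FreeGroup X) ∈ R then
    QuotientGroup.mk ⟨pair ⟨a.conj, ⟨a.rel, ha⟩, a.sign⟩, pair_mem_piTilde _⟩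
  else 1

theorem restrictedPair_incl (N : Subgroup (FreeGroup X)) (a : YSymbol R) :
    restrictedPair R N (a.incl h) = QuotientGroup.mk ⟨pair a, pair_mem_piTilde a⟩ :=
  dif_pos a.rel.2

theorem restrictedPair_inv (N : Subgroup (FreeGroup X)) (a : YSymbol S) :
    restrictedPair R N a.inv = restrictedPair R N a := by
  unfold restrictedPair
  split_ifs with h₁ h₂ h₂
  · congr 2
    exact pair_inv (R := R) ⟨a.conj, ⟨a.rel, h₂⟩, a.sign⟩
  · exact absurd h₁ h₂
  · exact absurd h₂ h₁
  · rfl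

theorem restrictedPair_comm (N : Subgroup (FreeGroup X)) (a b : YSymbol S) :
    restrictedPair R N a * restrictedPair R N b
      = restrictedPair R N b * restrictedPair R N a := by
  obtain ⟨x, hx⟩ := QuotientGroup.mk_surjective (restrictedPair R N a)
  obtain ⟨y, hy⟩ := QuotientGroup.mk_surjective (restrictedPair R N b)
  rw [← hx, ← hy, ← QuotientGroup.mk_mul, ← QuotientGroup.mk_mul]
  exact congrArg _ (Subtype.ext (piTilde_central x.2 y))

/-- This invariance lets `positiveLift` apply. If `a` belongs to the small presentation, `θ(a)`
fixes `Π̃₁` pointwise; otherwise `θ(a) ∈ N`, which acts trivially modulo the displacement subgroup.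
-/
theorem theta_smul_restrictedPair {N : Subgroup (FreeGroup X)}
    (hN : ∀ a : YSymbol S, (a.rel : FreeGroup X) ∉ R → a.theta ∈ N) (a b : YSymbol S) :
    restrictedPair R N (a.theta • b) = restrictedPair R N b := by
  by_cases hb : (b.rel : FreeGroup X) ∈ R
  · have hb' : ((a.theta • b).rel : FreeGroup X) ∈ R := hb
    rw [restrictedPair, restrictedPair, dif_pos hb, dif_pos hb']
    by_cases ha : (a.rel : FreeGroup X) ∈ R
    · congr 2
      exact theta_smul_pair (R := R) ⟨a.conj, ⟨a.rel, ha⟩, a.sign⟩ ⟨b.conj, ⟨b.rel, hb⟩, b.sign⟩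
    · refine mk_smul_eq_mk (hN a ha) ?_
      exact (smul_pair (R := R) a.theta ⟨b.conj, ⟨b.rel, hb⟩, b.sign⟩).symm
  · rw [restrictedPair, restrictedPair, dif_neg hb, dif_neg]
    exact hb

theorem phiHat_injective (hR : IsAspherical R) (hS : IsAspherical S) (N : Subgroup (FreeGroup X))
    (hN : N ≤ (thetaTilde (R := S)).range)
    (hRN : ∀ a : YSymbol S, (a.rel : FreeGroup X) ∉ R → a.theta ∈ N) :
    Function.Injective (phiHat h hS N hN) := by
  let ψ : GUpsilon S →* PiTilde R ⧸ displacement R N :=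
    positiveLift (restrictedPair R N) (restrictedPair_comm N) (theta_smul_restrictedPair hRN)
  -- `ψ ∘ f̂` is the quotient map on `cancelPairs R`, which is all of `Π̃₁` when `R` is aspherical.
  have key (d : GUpsilon R) (hd : d ∈ cancelPairs R) :
      ψ (fHat h d) = QuotientGroup.mk ⟨d, cancelPairs_le_piTilde hd⟩ := by
    induction hd using Subgroup.closure_induction with
    | mem x hx =>
      obtain ⟨a, rfl⟩ := hx
      rw [fHat_pair, ← restrictedPair_incl h]
      exact positiveLift_pair _ _ _ (restrictedPair_inv N) _
    | one => rw [map_one, map_one]; rfl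
    | mul x y _ _ hx hy => rw [map_mul, map_mul, hx, hy]; rfl
    | inv x _ hx => rw [map_inv, map_inv, hx]; rfl
  rw [injective_iff_map_eq_one]
  intro x hx
  obtain ⟨⟨d, hd⟩, rfl⟩ := QuotientGroup.mk_surjective x
  have h₁ : fHat h d = 1 := congrArg Subtype.val hx
  rw [← key d (isAspherical_iff.1 hR hd), h₁, map_one]

end Subpresentation

end Peiffer

open Peiffer
theorem mainTheorem2 {X : Type*} (R : Set (FreeGroup X)) (r₀ : FreeGroup X) (hr₀ : r₀ ∈ R)
    (hR : IsAspherical R) :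
    ∃ φ : (PiTilde (R \ {r₀}) ⧸ displacement (R \ {r₀}) (Subgroup.normalClosure {r₀})) →*
        AHat (Set.sdiff_subset : R \ {r₀} ⊆ R),
      (∀ d : PiTilde (R \ {r₀}),
        (φ (QuotientGroup.mk d) : GUpsilon R) = fHat Set.sdiff_subset (d : GUpsilon (R \ {r₀}))) ∧
      (IsAspherical (R \ {r₀}) ↔
        (∀ d : YSeq (R \ {r₀}), d.IsIdentity → ∀ n ∈ Subgroup.normalClosure {r₀},
          UpsilonPeifferEquiv (sigma (R \ {r₀}) (YSeq.act n d * YSeq.inv d)) 1) ∧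
        Function.Bijective φ) := by
  have hN := normalClosure_le_range_thetaTilde hr₀
  -- The only relator removed is `r₀`, so `θ(a)` is a conjugate of `r₀^{±1}`.
  have hRN (a : YSymbol R) (ha : (a.rel : FreeGroup X) ∉ R \ {r₀}) :
      a.theta ∈ Subgroup.normalClosure {r₀} := by
    have ha₀ : (a.rel : FreeGroup X) = r₀ := by
      by_contra hne
      exact ha ⟨a.rel.2, hne⟩
    rw [YSymbol.theta, ha₀]
    refine Subgroup.normalClosure_normal.conj_mem _ (zpow_mem ?_ _) _
    exact Subgroup.subset_normalClosure (Set.mem_singleton r₀)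
  refine ⟨phiHat Set.sdiff_subset hR (Subgroup.normalClosure {r₀}) hN, fun d => ?_, ?_, ?_⟩
  · exact phiHat_mk Set.sdiff_subset hR (Subgroup.normalClosure {r₀}) hN d
  · intro h
    refine ⟨fun d hd n _ => upsilonPeifferEquiv_of_isAspherical h hd n, ?_, ?_⟩
    · exact phiHat_injective Set.sdiff_subset h hR (Subgroup.normalClosure {r₀}) hN hRN
    · exact phiHat_surjective Set.sdiff_subset hR (Subgroup.normalClosure {r₀}) hN
  · intro h
    exact isAspherical_of_phiHat_injective Set.sdiff_subset hR (Subgroup.normalClosure {r₀}) hN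
      h.1 h.2.1
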